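/- Let $k$ be a field of characteristic zero and $R=k[x_1,\dots,x_4]$. For a point $P=[p_1:\dots:p_4]\in\mathbb P^3$ (points and open sets are taken over $k$), the linear form dual to $P$ is $\sum_i p_ix_i$ (defined up to a nonzero scalar). For a finite set $X\subset\mathbb P^3$ and an integer $d\ge 1$, let $\Lambda_{X,d}\subset R$ be the ideal generated by the $d$-th powers of the linear forms dual to the points of $X$. For a point $P\notin X$ and a plane $H\cong\mathbb P^2$ not containing $P$, let $\pi_P(X)\subset H$ be the projection of $X$ from $P$ to $H$. A finite set $X\subset\mathbb P^3$ is called $(a,b)$-geproci if, for a general point $P$, the homogeneous ideal $I_{\pi_P(X)}\subset k[\mathbb P^2]$ is generated by a regular sequence of two forms of degrees $a$ and $b$. "General" means: for all points of some nonempty Zariski open subset of $\mathbb P^3$. Let $X\subset\mathbb P^3$ be an $(a,b)$-geproci set. Then there is a nonempty Zariski open subset $U\subset\mathbb P^3$ such that for every $P\in U$, with dual linear form $\ell$, every integer $d\ge 1$ and every integer $t\ge 0$, the following holds for $A=R/\Lambda_{X,d}$ and the multiplication map $\times\ell:A_{d+t-1}\to A_{d+t}$. (a) For the projection $\overline X=\pi_P(X)$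 of $X$ from $P$ to any plane not containing $P$, $$\dim_k\operatorname{coker}(\times\ell)=\dim_k\big[I_{\overline X}^{\,t+1}\big]_{d+t}.$$ (b) If moreover $a\le b$ and $a(t+1)+b>d+t$, then $$\dim_k\operatorname{coker}(\times\ell)=\sum_{i=0}^{t+1}\binom{d+t+2-a(t+1)-(b-a)i}{2},$$ where $\binom{n}{2}=0$ for every integer $n<2$, including negative $n$. -/

import Mathlib

open MvPolynomial

namespace Geproci

noncomputable section

/-- The linear form `∑ vᵢ xᵢ` with coefficient vector `v`. -/
def linForm {k : Type*} [Field k] {n : ℕ} (v : Fin n → k) : MvPolynomial (Fin n) k :=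
  ∑ i, C (v i) * X i

theorem linForm_isHomogeneous {k : Type*} [Field k] {n : ℕ} (v : Fin n → k) :
    (linForm v).IsHomogeneous 1 :=
  IsHomogeneous.sum _ _ _ fun i _ => by
    simpa using (isHomogeneous_C (Fin n) (v i)).mul (isHomogeneous_X k i)

/-- The linear form dual to a projective point `P = [p₀ : ⋯]`, namely `∑ pᵢ xᵢ`. It is defined
up to a nonzero scalar, and we use the chosen representative of `P`. -/
def dualForm {k : Type*} [Field k] {n : ℕ} (P : Projectivization k (Fin n → k)) :
    MvPolynomial (Fin n) k :=
  linForm P.rep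

/-- The ideal `Λ_{X,d}` generated by the `d`-th powers of the linear forms dual to the points
of `X`. -/
def powerIdeal {k : Type*} [Field k] {n : ℕ} (X : Set (Projectivization k (Fin n → k))) (d : ℕ) :
    Ideal (MvPolynomial (Fin n) k) :=
  Ideal.span ((fun x => dualForm x ^ d) '' X)

/-- The homogeneous ideal `I_Z` of a set of projective points: it is generated by the forms
that vanish at all points of `Z`. -/
def vanishingIdeal {k : Type*} [Field k] {n : ℕ} (Z : Set (Projectivization k (Fin n → k))) :
    Ideal (MvPolynomial (Fin n) k) :=
  Ideal.span {F | (∃ m, F.IsHomogeneous m) ∧ ∀ z ∈ Z, ∀ v ∈ z.submodule, eval v F = 0}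

/-- The degree `m` piece `[J]_m` of a homogeneous ideal `J`. -/
def idealPiece {k : Type*} [Field k] {n : ℕ} (J : Ideal (MvPolynomial (Fin n) k)) (m : ℕ) :
    Submodule k (MvPolynomial (Fin n) k) :=
  J.restrictScalars k ⊓ homogeneousSubmodule (Fin n) k m

/-- The degree `m` piece `A_m` of the quotient `A = R/I`: the image of `R_m`. -/
def quotPiece {k : Type*} [Field k] {n : ℕ} (I : Ideal (MvPolynomial (Fin n) k)) (m : ℕ) :
    Submodule k (MvPolynomial (Fin n) k ⧸ I) :=
  (homogeneousSubmodule (Fin n) k m).map (Ideal.Quotient.mkₐ k I).toLinearMap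

theorem mul_mem_quotPiece {k : Type*} [Field k] {n : ℕ} (I : Ideal (MvPolynomial (Fin n) k))
    (P : Projectivization k (Fin n → k)) {m : ℕ} (hm : 0 < m)
    (x : MvPolynomial (Fin n) k ⧸ I) (hx : x ∈ quotPiece I (m - 1)) :
    LinearMap.mulLeft k (Ideal.Quotient.mk I (dualForm P)) x ∈ quotPiece I m := by
  obtain ⟨F, hF, rfl⟩ := hx
  refine ⟨dualForm P * F, ?_, by simp⟩
  have h := (linForm_isHomogeneous P.rep).mul ((mem_homogeneousSubmodule _ _).1 hF)
  rwa [Nat.add_sub_cancel' hm] at h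

/-- Multiplication by the linear form `ℓ` dual to `P`, as a map `A_{m-1} → A_m` where `A = R/I`
and `m` is positive. -/
def mulDual {k : Type*} [Field k] {n : ℕ} (I : Ideal (MvPolynomial (Fin n) k))
    (P : Projectivization k (Fin n → k)) {m : ℕ} (hm : 0 < m) :
    quotPiece I (m - 1) →ₗ[k] quotPiece I m :=
  (LinearMap.mulLeft k (Ideal.Quotient.mk I (dualForm P))).restrict (mul_mem_quotPiece I P hm)

/-- A property holds for a general point of projective space if it holds on a nonempty Zariski
open subset, equivalently (over an infinite field) on the complement of a hypersurface. -/
def ForGeneralPoint {k : Type*} [Field k] {n : ℕ}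
    (Q : Projectivization k (Fin n → k) → Prop) : Prop :=
  ∃ F : MvPolynomial (Fin n) k, (∃ m, F.IsHomogeneous m) ∧ F ≠ 0 ∧
    ∀ P : Projectivization k (Fin n → k), eval P.rep F ≠ 0 → Q P

/-- The projection `π_P(X)` of a set of points `X ⊆ ℙ³` from the point `P` to a plane `H` not
containing `P`, where `H` is identified with `ℙ²` through linear coordinates `e`. Here `H` is
given by the corresponding linear complement of the line `P` in `k⁴`. The point `P` itself has
no image. -/
def project {k : Type*} [Field k] (P : Projectivization k (Fin 4 → k))
    (H : Submodule k (Fin 4 → k)) (hH : IsCompl H P.submodule) (e : H ≃ₗ[k] (Fin 3 → k))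
    (X : Set (Projectivization k (Fin 4 → k))) : Set (Projectivization k (Fin 3 → k)) :=
  {y | ∃ x ∈ X, y.submodule =
    x.submodule.map (e.toLinearMap ∘ₗ H.projectionOnto P.submodule hH)}

/-- A set of points `Z ⊆ ℙ²` is a complete intersection of type `(a, b)`: its homogeneous ideal
is generated by a regular sequence of forms of degrees `a` and `b`. -/
def IsCompleteIntersection {k : Type*} [Field k] (a b : ℕ)
    (Z : Set (Projectivization k (Fin 3 → k))) : Prop :=
  ∃ f g : MvPolynomial (Fin 3) k, f.IsHomogeneous a ∧ g.IsHomogeneous b ∧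
    RingTheory.Sequence.IsRegular (MvPolynomial (Fin 3) k) [f, g] ∧
    vanishingIdeal Z = Ideal.span {f, g}

/-- A finite set of points `X ⊆ ℙ³` is `(a, b)`-geproci if its projection from a general point
to a plane is a complete intersection of type `(a, b)`. (Whether this holds does not depend on
the plane or on the coordinates on it.) -/
def IsGeproci {k : Type*} [Field k] (a b : ℕ)
    (X : Set (Projectivization k (Fin 4 → k))) : Prop :=
  X.Finite ∧ ForGeneralPoint fun P : Projectivization k (Fin 4 → k) =>
    ∀ (H : Submodule k (Fin 4 → k)) (hH : IsCompl H P.submodule) (e : H ≃ₗ[k] (Fin 3 → k)),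
      IsCompleteIntersection a b (project P H hH e X)

end

end Geproci

/-! Let `S` be the polynomial ring of the plane and let the substitution `R → S` kill `ℓ`. It sends
the form dual to a point `x ≠ P` to a form dual to the projection of `x`, so the cokernel is the
degree `d + t` piece of `S` modulo the `d`-th powers of the forms dual to the projected points
(`finrank_coker_mulDual`, `map_powerIdeal`).

Under the apolarity pairing, multiplication by a linear form is adjoint to a directional derivative.
By Macaulay duality that piece has the dimension of the space of forms of degree `d + t` vanishing
to order `t + 1` at every projected point (`finrank_quotient_powers`). This is a piece of a symbolic
power of the ideal of the projection. The geproci hypothesis makes that ideal a complete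
intersection of reduced points, for which symbolic and ordinary powers agree
(`mem_span_pair_pow_of_forall`). This gives (a).

For (b), the power is generated by the monomials `f ^ (t + 1 - i) * g ^ i`. Their first syzygies
occur in degree `a * (t + 1) + b`, so below it the dimension is a sum of dimensions of spaces of
ternary forms. -/

namespace Geproci

/-! ### Powers of an ideal generated by a regular pair. -/

section RegularPair

variable {S : Type*} [CommRing S] {f g : S}

/-- Elements of a power of the ideal `(f, g)` are combinations of the monomials in `f` and `g`. -/
theorem exists_sum_of_mem_span_pair_pow {n : ℕ} {x : S} (hx : x ∈ Ideal.span {f, g} ^ n) :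
    ∃ c : ℕ → S, x = ∑ i ∈ Finset.range (n + 1), c i * (f ^ (n - i) * g ^ i) := by
  induction n generalizing x with
  | zero => exact ⟨fun _ => x, by simp⟩
  | succ n ih =>
    rw [pow_succ] at hx
    induction hx using Submodule.mul_induction_on' with
    | mem_mul_mem r hr s hs =>
      obtain ⟨c, rfl⟩ := ih hr
      obtain ⟨y, z, rfl⟩ := Ideal.mem_span_pair.1 hs
      -- Multiplying by `y * f` keeps the index of a monomial and multiplying by `z * g` raises it
      -- by one; the guards discard the index `n + 1` in the first sum and `0` in the second.
      refine ⟨fun i => (if i ≤ n then c i * y else 0) + (if i = 0 then 0 else c (i - 1) * z), ?_⟩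
      simp only [add_mul, Finset.sum_add_distrib]
      rw [mul_add, Finset.sum_range_succ (n := n + 1), Finset.sum_range_succ' (n := n + 1)]
      simp only [Finset.sum_mul]
      congr 1
      · rw [if_neg (by omega), zero_mul, add_zero]
        refine Finset.sum_congr rfl fun i hi => ?_
        have hi' : i ≤ n := Nat.lt_succ_iff.1 (Finset.mem_range.1 hi)
        rw [if_pos hi', Nat.sub_add_comm hi']
        ring
      · simp only [Nat.add_eq_zero_iff, one_ne_zero, and_false, if_false, if_true, zero_mul,
          add_zero, Nat.add_sub_cancel, Nat.add_sub_add_right]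
        exact Finset.sum_congr rfl fun i _ => by ring
    | add r _ s _ hr hs =>
      obtain ⟨c, rfl⟩ := hr
      obtain ⟨c', rfl⟩ := hs
      exact ⟨fun i => c i + c' i, by simp only [add_mul, Finset.sum_add_distrib]⟩

theorem sum_mem_span_pair_pow (n : ℕ) (c : ℕ → S) :
    ∑ i ∈ Finset.range (n + 1), c i * (f ^ (n - i) * g ^ i) ∈ Ideal.span {f, g} ^ n := by
  refine Ideal.sum_mem _ fun i hi => Ideal.mul_mem_left _ _ ?_
  have hi' : i ≤ n := Nat.lt_succ_iff.1 (Finset.mem_range.1 hi)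
  have h := Ideal.mul_mem_mul
    (Ideal.pow_mem_pow (Ideal.subset_span (Set.mem_insert f {g})) (n - i))
    (Ideal.pow_mem_pow (Ideal.subset_span (Set.mem_insert_of_mem f rfl) :
      g ∈ Ideal.span {f, g}) i)
  rwa [← pow_add, Nat.sub_add_cancel hi'] at h

/-- The inductive step for relations between the monomials of degree `n + 1` in a regular
sequence: the last coefficient is divisible by `f`, and a relation in degree `n` remains. -/
theorem relation_step (hf : ∀ c, f * c = 0 → c = 0) (hg : ∀ c, f ∣ g * c → f ∣ c) {n : ℕ}
    {c : ℕ → S} (hc : ∑ i ∈ Finset.range (n + 2), c i * (f ^ (n + 1 - i) * g ^ i) = 0) :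
    ∃ q, c (n + 1) = f * q ∧
      ∑ i ∈ Finset.range (n + 1), (c i + if i = n then q * g else 0) * (f ^ (n - i) * g ^ i)
        = 0 := by
  have hs : ∑ i ∈ Finset.range (n + 1), c i * (f ^ (n + 1 - i) * g ^ i) =
      f * ∑ i ∈ Finset.range (n + 1), c i * (f ^ (n - i) * g ^ i) := by
    rw [Finset.mul_sum]
    refine Finset.sum_congr rfl fun i hi => ?_
    rw [Nat.sub_add_comm (Nat.lt_succ_iff.1 (Finset.mem_range.1 hi))]
    ring
  rw [Finset.sum_range_succ, hs, Nat.sub_self, pow_zero, one_mul] at hc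
  have hg' : ∀ m c, f ∣ g ^ m * c → f ∣ c := by
    intro m
    induction m with
    | zero => simp
    | succ m ih =>
      intro c h
      exact hg c (ih _ (by rwa [pow_succ, mul_assoc] at h))
  obtain ⟨q, hq⟩ := hg' (n + 1) (c (n + 1))
    ⟨-∑ i ∈ Finset.range (n + 1), c i * (f ^ (n - i) * g ^ i), by linear_combination hc⟩
  -- The last term is now `f * q * g ^ (n + 1)`; its factor `q * g` is absorbed into the coefficient
  -- of `g ^ n`, and `f` cancels from the whole relation.
  refine ⟨q, hq, hf _ ?_⟩
  rw [hq] at hc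
  simp only [add_mul, Finset.sum_add_distrib, ite_mul, zero_mul, Finset.sum_ite_eq',
    Finset.mem_range, Nat.lt_succ_self, if_true, Nat.sub_self, pow_zero, one_mul]
  linear_combination hc

/-- A regular sequence `f, g` is quasi-regular: the coefficients of a relation between the
monomials of degree `n` in `f` and `g` lie in `(f, g)`. -/
theorem coeff_mem_of_relation (hf : ∀ c, f * c = 0 → c = 0) (hg : ∀ c, f ∣ g * c → f ∣ c)
    {n : ℕ} (hn : 0 < n) {c : ℕ → S}
    (hc : ∑ i ∈ Finset.range (n + 1), c i * (f ^ (n - i) * g ^ i) = 0) :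
    ∀ i ≤ n, c i ∈ Ideal.span {f, g} := by
  have hfm : f ∈ Ideal.span {f, g} := Ideal.subset_span (Set.mem_insert f {g})
  have hgm : g ∈ Ideal.span {f, g} := Ideal.subset_span (Set.mem_insert_of_mem f rfl)
  induction n generalizing c with
  | zero => omega
  | succ n ih =>
    obtain ⟨q, hq, h⟩ := relation_step hf hg hc
    intro i hi
    rcases hi.eq_or_lt with rfl | hi
    · exact hq ▸ Ideal.mul_mem_right _ _ hfm
    · have hi' : c i + (if i = n then q * g else 0) ∈ Ideal.span {f, g} := by
        rcases n.eq_zero_or_pos with rfl | hn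
        · obtain rfl : i = 0 := by omega
          simp only [zero_add, Finset.sum_range_one, if_true, Nat.sub_self, pow_zero,
            mul_one] at h ⊢
          exact h ▸ Ideal.zero_mem _
        · exact ih hn h i (by omega)
      refine (Ideal.add_mem_iff_left _ ?_).1 hi'
      split_ifs
      · exact Ideal.mul_mem_left _ _ hgm
      · exact Ideal.zero_mem _

/-- If `(f, g)` is generated by a regular sequence and is an intersection of finitely many
pairwise incomparable primes, then its symbolic powers are its ordinary powers. -/
theorem mem_span_pair_pow_of_forall (hf : ∀ c, f * c = 0 → c = 0)
    (hg : ∀ c, f ∣ g * c → f ∣ c) {ι : Type*} [Finite ι] {J : ι → Ideal S}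
    (hJ : ∀ i, (J i).IsPrime) (hanti : ∀ i j, J i ≤ J j → i = j)
    (hI : Ideal.span {f, g} = ⨅ i, J i) (n : ℕ) {x : S} (hx : ∀ i, x ∈ J i ^ n) :
    x ∈ Ideal.span {f, g} ^ n := by
  classical
  have := Fintype.ofFinite ι
  -- By incomparability, some `s` lies in every other prime but not in `J i`; it carries `J i` into
  -- the intersection.
  have hsep : ∀ i, ∃ s ∉ J i, ∀ y ∈ J i, s * y ∈ Ideal.span {f, g} := by
    intro i
    have h : ¬ (Finset.univ.erase i).inf J ≤ J i := by
      rw [(hJ i).inf_le']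
      rintro ⟨j, hj, hji⟩
      exact (Finset.mem_erase.1 hj).1 (hanti _ _ hji)
    obtain ⟨s, hs, hsi⟩ := SetLike.not_le_iff_exists.1 h
    refine ⟨s, hsi, fun y hy => ?_⟩
    rw [hI, Ideal.mem_iInf]
    intro j
    by_cases hj : j = i
    · exact hj ▸ Ideal.mul_mem_left _ _ hy
    · exact Ideal.mul_mem_right _ _
        ((Finset.inf_le (Finset.mem_erase.2 ⟨hj, Finset.mem_univ j⟩) :
          (Finset.univ.erase i).inf J ≤ J j) hs)
  induction n with
  | zero => simp
  | succ n ih =>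
    rcases n.eq_zero_or_pos with rfl | hn
    · simpa [hI, Ideal.mem_iInf] using hx
    obtain ⟨c, rfl⟩ := exists_sum_of_mem_span_pair_pow
      (ih fun i => Ideal.pow_le_pow_right n.le_succ (hx i))
    -- With `x` already in the `n`-th power, one more power is gained by showing that all
    -- coefficients lie in each `J i`.
    have hc : ∀ j ≤ n, c j ∈ Ideal.span {f, g} := by
      intro j hj
      rw [hI, Ideal.mem_iInf]
      intro i
      obtain ⟨s, hs, hsy⟩ := hsep i
      have hle : ∀ y ∈ J i ^ (n + 1), s ^ (n + 1) * y ∈ Ideal.span {f, g} ^ (n + 1) := by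
        intro y hy
        have h1 : s ^ (n + 1) * y ∈ (Ideal.span {s} * J i) ^ (n + 1) := by
          rw [mul_pow]
          exact Ideal.mul_mem_mul (Ideal.pow_mem_pow (Ideal.mem_span_singleton_self s) _) hy
        refine Ideal.pow_right_mono ?_ (n + 1) h1
        rw [Ideal.span_singleton_mul_le_iff]
        exact hsy
      have h2 := hle _ (hx i)
      rw [pow_succ (Ideal.span {f, g})] at h2
      -- An element of the power `n + 1` is also a combination of the monomials of degree `n` with
      -- coefficients in `(f, g)`. Comparing with `s ^ (n + 1) * x`, quasi-regularity puts `s ^ (n +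
      -- 1) * c j` in `(f, g)`, and `s` can be removed modulo the prime `J i`.
      have h3 : ∃ e : ℕ → S, (∀ j, e j ∈ Ideal.span {f, g}) ∧
          s ^ (n + 1) * ∑ i ∈ Finset.range (n + 1), c i * (f ^ (n - i) * g ^ i) =
            ∑ i ∈ Finset.range (n + 1), e i * (f ^ (n - i) * g ^ i) := by
        generalize s ^ (n + 1) * ∑ i ∈ Finset.range (n + 1), c i * (f ^ (n - i) * g ^ i) = y
          at h2
        induction h2 using Submodule.mul_induction_on' with
        | mem_mul_mem r hr z hz =>
          obtain ⟨e, rfl⟩ := exists_sum_of_mem_span_pair_pow hr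
          refine ⟨fun i => e i * z, fun i => Ideal.mul_mem_left _ _ hz, ?_⟩
          rw [Finset.sum_mul]
          exact Finset.sum_congr rfl fun i _ => by ring
        | add r _ z _ hr hz =>
          obtain ⟨e, he, rfl⟩ := hr
          obtain ⟨e', he', rfl⟩ := hz
          exact ⟨fun i => e i + e' i, fun i => Ideal.add_mem _ (he i) (he' i),
            by simp only [add_mul, Finset.sum_add_distrib]⟩
      obtain ⟨e, he, hee⟩ := h3
      have h4 : ∑ i ∈ Finset.range (n + 1), (s ^ (n + 1) * c i - e i) * (f ^ (n - i) * g ^ i)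
          = 0 := by
        simp only [sub_mul, Finset.sum_sub_distrib, ← hee, Finset.mul_sum, mul_assoc, sub_self]
      have h5 := coeff_mem_of_relation hf hg hn h4 j hj
      have h6 : s ^ (n + 1) * c j ∈ J i :=
        (hI.le.trans (iInf_le J i)) (by simpa using Ideal.add_mem _ h5 (he j))
      exact ((hJ i).mem_or_mem h6).resolve_left fun h => hs ((hJ i).mem_of_pow_mem _ h)
    rw [pow_succ']
    have h7 : ∀ i ∈ Finset.range (n + 1), c i * (f ^ (n - i) * g ^ i) ∈
        Ideal.span {f, g} * Ideal.span {f, g} ^ n := by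
      intro i hi
      refine Ideal.mul_mem_mul (hc i (Nat.lt_succ_iff.1 (Finset.mem_range.1 hi))) ?_
      have := sum_mem_span_pair_pow (f := f) (g := g) n (Pi.single i 1)
      simpa [Pi.single_apply, ite_mul, hi] using this
    exact Ideal.sum_mem _ h7

open scoped Pointwise in
/-- The two conditions expressing that `f, g` is a regular sequence. -/
theorem dvd_of_isRegular (h : RingTheory.Sequence.IsRegular S [f, g]) :
    (∀ c, f * c = 0 → c = 0) ∧ ∀ c, f ∣ g * c → f ∣ c := by
  have h1 := (RingTheory.Sequence.isWeaklyRegular_cons_iff S f [g]).1 h.toIsWeaklyRegular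
  have h2 := (RingTheory.Sequence.isWeaklyRegular_cons_iff _ g []).1 h1.2
  have hmem : ∀ c : S, c ∈ (f • (⊤ : Submodule S S)) ↔ f ∣ c := by
    intro c
    rw [Submodule.mem_smul_pointwise_iff_exists]
    simp only [Submodule.mem_top, true_and, smul_eq_mul]
    exact ⟨fun ⟨y, hy⟩ => ⟨y, hy.symm⟩, fun ⟨y, hy⟩ => ⟨y, hy.symm⟩⟩
  refine ⟨fun c hc => h1.1 (by simpa using hc), fun c hc => ?_⟩
  have h3 : g • (Submodule.Quotient.mk c : QuotSMulTop f S) = g • 0 := by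
    rw [smul_zero, ← Submodule.Quotient.mk_smul, Submodule.Quotient.mk_eq_zero, hmem]
    exact hc
  have h4 := h2.1 h3
  rwa [Submodule.Quotient.mk_eq_zero, hmem] at h4

end RegularPair

end Geproci

namespace Geproci

noncomputable section

/-! ### The prime ideal of a line through the origin. -/

section LineIdeal

variable {k : Type*} [Field k] {n : ℕ}

/-- Restriction of a polynomial to the line spanned by `v`. -/
def restrictLine (v : Fin n → k) : MvPolynomial (Fin n) k →ₐ[k] Polynomial k :=
  aeval fun i => Polynomial.C (v i) * Polynomial.X

/-- The ideal of the line spanned by `v`. -/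
def lineIdeal (v : Fin n → k) : Ideal (MvPolynomial (Fin n) k) :=
  RingHom.ker (restrictLine v)

theorem lineIdeal_isPrime (v : Fin n → k) : (lineIdeal v).IsPrime :=
  RingHom.ker_isPrime _

theorem mem_lineIdeal {v : Fin n → k} {F : MvPolynomial (Fin n) k} :
    F ∈ lineIdeal v ↔ restrictLine v F = 0 :=
  RingHom.mem_ker

theorem restrictLine_of_isHomogeneous (v : Fin n → k) {F : MvPolynomial (Fin n) k} {m : ℕ}
    (hF : F.IsHomogeneous m) :
    restrictLine v F = Polynomial.C (eval v F) * Polynomial.X ^ m := by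
  rw [restrictLine, aeval_def, eval₂_eq', eval_eq', map_sum, Finset.sum_mul]
  refine Finset.sum_congr rfl fun α hα => ?_
  have hm : ∑ i, α i = m := by
    rw [hF.degree_eq_sum_deg_support hα]
    exact (Finsupp.degree_eq_sum α).symm
  simp only [mul_pow, Finset.prod_mul_distrib, Finset.prod_pow_eq_pow_sum, hm, map_mul, map_prod,
    map_pow, Polynomial.algebraMap_eq, mul_assoc]

theorem mem_lineIdeal_of_isHomogeneous {v : Fin n → k} {F : MvPolynomial (Fin n) k} {m : ℕ}
    (hF : F.IsHomogeneous m) : F ∈ lineIdeal v ↔ eval v F = 0 := by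
  rw [mem_lineIdeal, restrictLine_of_isHomogeneous v hF]
  simp

theorem eval_smul_eq (v : Fin n → k) (c : k) (F : MvPolynomial (Fin n) k) :
    eval (c • v) F = (restrictLine v F).eval c := by
  induction F using MvPolynomial.induction_on with
  | C a => simp [restrictLine]
  | add p q hp hq => simp [hp, hq]
  | mul_X p i hp => simp [hp, restrictLine, mul_comm c]

/-- Components of different degrees restrict to different powers of the parameter on the line, so
they cannot cancel. -/
theorem homogeneousComponent_mem_lineIdeal {v : Fin n → k} {F : MvPolynomial (Fin n) k}
    (hF : F ∈ lineIdeal v) (m : ℕ) : homogeneousComponent m F ∈ lineIdeal v := by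
  rw [mem_lineIdeal_of_isHomogeneous (homogeneousComponent_isHomogeneous m F)]
  rw [mem_lineIdeal, ← sum_homogeneousComponent F, map_sum] at hF
  by_cases hm : m < F.totalDegree + 1
  · have h := congrArg (Polynomial.coeff · m) hF
    simp only [restrictLine_of_isHomogeneous v (homogeneousComponent_isHomogeneous _ F),
      Polynomial.finsetSum_coeff, Polynomial.coeff_C_mul_X_pow, Polynomial.coeff_zero,
      Finset.sum_ite_eq, Finset.mem_range, hm, if_true] at h
    exact h
  · rw [homogeneousComponent_eq_zero _ _ (by omega), map_zero]

theorem lineIdeal_le_idealOfVars (v : Fin n → k) : lineIdeal v ≤ idealOfVars (Fin n) k := by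
  intro F hF
  have h := homogeneousComponent_mem_lineIdeal hF 0
  rw [homogeneousComponent_zero, mem_lineIdeal] at h
  rw [← pow_one (idealOfVars (Fin n) k), mem_pow_idealOfVars_iff']
  intro α hα
  obtain rfl : α = 0 := (Finsupp.degree_eq_zero_iff α).1 (by omega)
  simpa [restrictLine] using h

end LineIdeal

/-! ### Directional derivatives and order of vanishing along a line. -/

section Derivative

variable {k : Type*} [Field k] {n : ℕ}

/-- The derivative in the direction of `v`. -/
def dirDeriv (v : Fin n → k) :
    Derivation k (MvPolynomial (Fin n) k) (MvPolynomial (Fin n) k) :=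
  mkDerivation k fun i => C (v i)

@[simp]
theorem dirDeriv_X (v : Fin n → k) (i : Fin n) : dirDeriv v (X i) = C (v i) :=
  mkDerivation_X _ _ _

theorem dirDeriv_apply (v : Fin n → k) (F : MvPolynomial (Fin n) k) :
    dirDeriv v F = ∑ i, C (v i) * pderiv i F := by
  induction F using MvPolynomial.induction_on with
  | C a => simp [dirDeriv]
  | add p q hp hq => simp only [map_add, hp, hq, mul_add, Finset.sum_add_distrib]
  | mul_X p i hp =>
    simp only [Derivation.leibniz, dirDeriv_X, hp, smul_eq_mul, mul_add, Finset.sum_add_distrib,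
      Finset.mul_sum, pderiv_X]
    congr 1
    · simp [Pi.single_apply, mul_comm]
    · exact Finset.sum_congr rfl fun j _ => by ring

theorem restrictLine_dirDeriv (v : Fin n → k) (F : MvPolynomial (Fin n) k) :
    restrictLine v (dirDeriv v F) = (restrictLine v F).derivative := by
  induction F using MvPolynomial.induction_on with
  | C a => simp [restrictLine, dirDeriv]
  | add p q hp hq => simp [hp, hq]
  | mul_X p i hp =>
    rw [Derivation.leibniz, map_add, smul_eq_mul, smul_eq_mul, map_mul, map_mul, hp, dirDeriv_X]
    simp [restrictLine]
    ring

/-- No power is lost: the derivative is tangent to the line, hence preserves `lineIdeal v` itself,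
and the Leibniz rule extends this to powers. -/
theorem dirDeriv_mem_lineIdeal_pow {v : Fin n → k} {F : MvPolynomial (Fin n) k} {m : ℕ}
    (hF : F ∈ lineIdeal v ^ m) : dirDeriv v F ∈ lineIdeal v ^ m := by
  induction m generalizing F with
  | zero => simp
  | succ m ih =>
    rw [pow_succ] at hF ⊢
    induction hF using Submodule.mul_induction_on' with
    | mem_mul_mem r hr s hs =>
      rw [Derivation.leibniz, smul_eq_mul, smul_eq_mul, mul_comm s]
      refine Ideal.add_mem _ (Ideal.mul_mem_mul hr ?_) (Ideal.mul_mem_mul (ih hr) hs)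
      rw [mem_lineIdeal] at hs ⊢
      rw [restrictLine_dirDeriv, hs, Polynomial.derivative_zero]
    | add r _ s _ hr hs =>
      rw [map_add]
      exact Ideal.add_mem _ hr hs

theorem dirDeriv_isHomogeneous (v : Fin n → k) {F : MvPolynomial (Fin n) k} {m : ℕ}
    (hF : F.IsHomogeneous m) : (dirDeriv v F).IsHomogeneous (m - 1) := by
  rw [dirDeriv_apply]
  exact IsHomogeneous.sum _ _ _ fun i _ => hF.pderiv.C_mul _

theorem iterate_dirDeriv_isHomogeneous (v : Fin n → k) {F : MvPolynomial (Fin n) k} {m : ℕ}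
    (hF : F.IsHomogeneous m) (d : ℕ) : ((dirDeriv v)^[d] F).IsHomogeneous (m - d) := by
  induction d with
  | zero => exact hF
  | succ d ih =>
    rw [Function.iterate_succ_apply', ← Nat.sub_sub]
    exact dirDeriv_isHomogeneous v ih

/-- The commutator is a derivation that kills the variables. -/
theorem pderiv_dirDeriv_comm (v : Fin n → k) (i : Fin n) (F : MvPolynomial (Fin n) k) :
    pderiv i (dirDeriv v F) = dirDeriv v (pderiv i F) := by
  have h : ⁅pderiv (R := k) i, dirDeriv v⁆ = 0 := by
    refine MvPolynomial.derivation_ext fun j => ?_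
    rw [Derivation.commutator_apply, dirDeriv_X]
    simp [Pi.single_apply, apply_ite (dirDeriv v)]
  have h' := congrArg (fun D => D F) h
  rwa [Derivation.commutator_apply, Derivation.zero_apply, sub_eq_zero] at h'

/-- The iterated derivative has degree `t` but stays in `lineIdeal v ^ (t + 1)`, whose elements have
no terms of degree below `t + 1`. -/
theorem iterate_dirDeriv_eq_zero_of_mem {v : Fin n → k} {F : MvPolynomial (Fin n) k} {d t : ℕ}
    (hF : F.IsHomogeneous (d + t)) (h : F ∈ lineIdeal v ^ (t + 1)) :
    (dirDeriv v)^[d] F = 0 := by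
  have h1 : ∀ e, (dirDeriv v)^[e] F ∈ lineIdeal v ^ (t + 1) := by
    intro e
    induction e with
    | zero => exact h
    | succ e ih =>
      rw [Function.iterate_succ_apply']
      exact dirDeriv_mem_lineIdeal_pow ih
  have h2 := iterate_dirDeriv_isHomogeneous v hF d
  rw [Nat.add_sub_cancel_left] at h2
  have h3 := (mem_pow_idealOfVars_iff' _ _).1
    (Ideal.pow_right_mono (lineIdeal_le_idealOfVars v) _ (h1 d))
  ext α
  by_cases hα : α.degree = t
  · exact h3 α (by omega)
  · exact h2.coeff_eq_zero hα

variable [CharZero k]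

/-- Induction on the degree: the order of vanishing of `F` is recovered from those of its
derivatives by Euler's formula. -/
theorem mem_lineIdeal_pow_of_iterate_dirDeriv_eq_zero {v : Fin n → k} (hv : v ≠ 0)
    {F : MvPolynomial (Fin n) k} {m d : ℕ} (hF : F.IsHomogeneous m)
    (h : (dirDeriv v)^[d] F = 0) : F ∈ lineIdeal v ^ (m + 1 - d) := by
  induction m generalizing F d with
  | zero =>
    rcases d with _ | d
    · rw [Function.iterate_zero_apply] at h
      exact h ▸ Ideal.zero_mem _
    · simp
  | succ m ih =>
    rcases d with _ | d
    · rw [Function.iterate_zero_apply] at h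
      exact h ▸ Ideal.zero_mem _
    obtain ⟨j, hj⟩ := Function.ne_iff.1 hv
    rw [Pi.zero_apply] at hj
    have h1 : dirDeriv v F ∈ lineIdeal v ^ (m + 1 - d) :=
      ih (dirDeriv_isHomogeneous v hF) (by rwa [Function.iterate_succ_apply] at h)
    have h2 : ∀ i, pderiv i F ∈ lineIdeal v ^ (m - d) := by
      intro i
      have hi : (dirDeriv v)^[d + 1] (pderiv i F) = 0 := by
        have hc := (show Function.Semiconj (pderiv (R := k) i) (dirDeriv v) (dirDeriv v) from
          pderiv_dirDeriv_comm v i).iterate_right (d + 1) F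
        rw [← hc, h, map_zero]
      simpa using ih hF.pderiv hi
    have h3 : ∀ i, X i - C (v i * (v j)⁻¹) * X j ∈ lineIdeal v := by
      intro i
      rw [mem_lineIdeal_of_isHomogeneous ((isHomogeneous_X k i).sub
        (isHomogeneous_C_mul_X _ j))]
      simp [hj]
    -- Euler's formula, rearranged so that each `pderiv i F` is multiplied by a linear form
    -- vanishing on the line, which makes up for the power missing in `h2`; the `dirDeriv` term
    -- needs no such factor by `h1`.
    have h4 : (C ((m + 1 : ℕ) : k)) * F =
        ∑ i, (X i - C (v i * (v j)⁻¹) * X j) * pderiv i F + C (v j)⁻¹ * X j * dirDeriv v F := by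
      have he := hF.sum_X_mul_pderiv
      rw [nsmul_eq_mul] at he
      rw [map_natCast, ← he, dirDeriv_apply, Finset.mul_sum, ← Finset.sum_add_distrib]
      refine Finset.sum_congr rfl fun i _ => ?_
      rw [C_mul]
      ring
    have h5 : C ((m + 1 : ℕ) : k) * F ∈ lineIdeal v ^ (m + 1 - d) := by
      rw [h4]
      refine Ideal.add_mem _ (Ideal.sum_mem _ fun i _ => ?_) (Ideal.mul_mem_left _ _ h1)
      refine Ideal.pow_le_pow_right (by omega : m + 1 - d ≤ (m - d) + 1) ?_
      rw [pow_succ']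
      exact Ideal.mul_mem_mul (h3 i) (h2 i)
    have h6 := Ideal.mul_mem_left _ (C ((m + 1 : ℕ) : k)⁻¹) h5
    rw [← mul_assoc, ← C_mul, inv_mul_cancel₀ (Nat.cast_ne_zero.2 m.succ_ne_zero), C_1,
      one_mul] at h6
    rwa [Nat.add_sub_add_right]

/-- A form of degree `d + t` vanishes to order `t + 1` along the line spanned by `v` if and only
if its `d`-th derivative in the direction of `v` is zero. -/
theorem iterate_dirDeriv_eq_zero_iff {v : Fin n → k} (hv : v ≠ 0) {F : MvPolynomial (Fin n) k}
    {d t : ℕ} (hF : F.IsHomogeneous (d + t)) :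
    (dirDeriv v)^[d] F = 0 ↔ F ∈ lineIdeal v ^ (t + 1) := by
  refine ⟨fun h => ?_, iterate_dirDeriv_eq_zero_of_mem hF⟩
  have := mem_lineIdeal_pow_of_iterate_dirDeriv_eq_zero hv hF h
  rwa [add_assoc, Nat.add_sub_cancel_left] at this

end Derivative

/-! ### Apolarity and Macaulay duality. -/

section Apolarity

variable {k : Type*} [Field k] {n : ℕ}

/-- The apolarity pairing, for which the monomials are orthogonal and `x ^ α` has square `α!`. -/
def apolar : MvPolynomial (Fin n) k →ₗ[k] MvPolynomial (Fin n) k →ₗ[k] k :=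
  (basisMonomials (Fin n) k).constr k fun α => ((∏ i, (α i).factorial : ℕ) : k) • lcoeff k α

theorem apolar_monomial (α : Fin n →₀ ℕ) (c : k) (F : MvPolynomial (Fin n) k) :
    apolar (monomial α c) F = c * ((∏ i, (α i).factorial : ℕ) * coeff α F) := by
  have h : monomial α c = c • basisMonomials (Fin n) k α := by
    rw [coe_basisMonomials, smul_monomial, smul_eq_mul, mul_one]
  rw [h, map_smul, apolar, Module.Basis.constr_basis]
  simp

theorem apolar_comm (F G : MvPolynomial (Fin n) k) : apolar F G = apolar G F := by
  induction F using MvPolynomial.induction_on' with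
  | add p q hp hq => simp [hp, hq]
  | monomial α a =>
    induction G using MvPolynomial.induction_on' with
    | add p q hp hq => simp only [map_add, hp, hq, LinearMap.add_apply]
    | monomial β b =>
      classical
      rw [apolar_monomial, apolar_monomial, coeff_monomial, coeff_monomial]
      by_cases h : α = β
      · subst h
        simp only [if_true]
        ring
      · rw [if_neg h, if_neg (Ne.symm h), mul_zero, mul_zero, mul_zero, mul_zero]

/-- The factor `α i + 1` gained by the factorial when `α i` is raised is the one produced by
differentiation. -/
theorem apolar_X_mul (i : Fin n) (G F : MvPolynomial (Fin n) k) :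
    apolar (X i * G) F = apolar G (pderiv i F) := by
  induction G using MvPolynomial.induction_on' with
  | add p q hp hq => simp only [mul_add, map_add, LinearMap.add_apply, hp, hq]
  | monomial α a =>
    have h : ∏ j, ((α + Finsupp.single i 1 : Fin n →₀ ℕ) j).factorial =
        (α i + 1) * ∏ j, (α j).factorial := by
      rw [← Finset.mul_prod_erase _ _ (Finset.mem_univ i),
        ← Finset.mul_prod_erase _ (fun j => (α j).factorial) (Finset.mem_univ i), ← mul_assoc]
      congr 1
      · simp [Nat.factorial_succ]
      · refine Finset.prod_congr rfl fun j hj => ?_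
        simp [(Finset.ne_of_mem_erase hj).symm]
    rw [X, monomial_mul, one_mul, add_comm, apolar_monomial, apolar_monomial, coeff_pderiv, h]
    push_cast
    ring

theorem apolar_linForm_mul (v : Fin n → k) (G F : MvPolynomial (Fin n) k) :
    apolar (linForm v * G) F = apolar G (dirDeriv v F) := by
  simp only [linForm, dirDeriv_apply, Finset.sum_mul, map_sum, LinearMap.sum_apply,
    C_mul', map_smul, LinearMap.smul_apply, smul_mul_assoc, apolar_X_mul]

theorem apolar_linForm_pow_mul (v : Fin n → k) (d : ℕ) (G F : MvPolynomial (Fin n) k) :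
    apolar (linForm v ^ d * G) F = apolar G ((dirDeriv v)^[d] F) := by
  induction d generalizing F with
  | zero => simp
  | succ d ih =>
    rw [pow_succ', mul_assoc, apolar_linForm_mul, ih, Function.iterate_succ_apply]

variable [CharZero k]

/-- Pairing with monomials recovers the coefficients up to factorials, which are nonzero in
characteristic zero. -/
theorem eq_zero_of_apolar_eq_zero {F : MvPolynomial (Fin n) k} {m : ℕ} (hF : F.IsHomogeneous m)
    (h : ∀ G : MvPolynomial (Fin n) k, G.IsHomogeneous m → apolar G F = 0) : F = 0 := by
  ext α
  by_cases hα : α.degree = m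
  · have h1 := h (monomial α 1) (isHomogeneous_monomial _ hα)
    rw [apolar_monomial, one_mul, mul_eq_zero, Nat.cast_eq_zero] at h1
    exact h1.resolve_left (Finset.prod_ne_zero_iff.2 fun i _ => Nat.factorial_ne_zero _)
  · exact hF.coeff_eq_zero hα

instance finite_homogeneousSubmodule (m : ℕ) :
    Module.Finite k (homogeneousSubmodule (Fin n) k m) :=
  Module.Finite.iff_fg.2 (homogeneousSubmodule_fg (Fin n) k m)

/-- The apolarity pairing on forms of degree `m`. -/
def apolarForm (k : Type*) [Field k] (n m : ℕ) :
    LinearMap.BilinForm k (homogeneousSubmodule (Fin n) k m) :=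
  apolar.domRestrict₁₂ _ _

omit [CharZero k] in
theorem apolarForm_apply {m : ℕ} (F G : homogeneousSubmodule (Fin n) k m) :
    apolarForm k n m F G = apolar (F : MvPolynomial (Fin n) k) G := rfl

theorem apolarForm_nondegenerate (m : ℕ) : (apolarForm k n m).Nondegenerate := by
  have h : ∀ F, (∀ G, apolarForm k n m G F = 0) → F = 0 := fun F hF =>
    Subtype.ext (eq_zero_of_apolar_eq_zero F.2 fun G hG => hF ⟨G, hG⟩)
  refine ⟨fun F hF => h F fun G => ?_, h⟩
  rw [apolarForm_apply, apolar_comm]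
  exact hF G

/-- Forms apolar to an ideal generated by powers of linear forms are those that vanish to high
order along the corresponding lines. -/
theorem apolar_powers_iff {A : Set (Fin n → k)} (hA : ∀ v ∈ A, v ≠ 0) {d t : ℕ}
    {F : MvPolynomial (Fin n) k} (hF : F.IsHomogeneous (d + t)) :
    (∀ G ∈ Ideal.span ((fun v => linForm v ^ d) '' A), G.IsHomogeneous (d + t) →
      apolar G F = 0) ↔ ∀ v ∈ A, F ∈ lineIdeal v ^ (t + 1) := by
  constructor
  · intro h v hv
    rw [← iterate_dirDeriv_eq_zero_iff (hA v hv) hF]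
    have hd := iterate_dirDeriv_isHomogeneous v hF d
    rw [Nat.add_sub_cancel_left] at hd
    refine eq_zero_of_apolar_eq_zero hd fun G hG => ?_
    rw [← apolar_linForm_pow_mul]
    refine h _ (Ideal.mul_mem_right _ _ (Ideal.subset_span ⟨v, hv, rfl⟩)) ?_
    simpa using ((linForm_isHomogeneous v).pow d).mul hG
  · intro h G hG _
    -- An arbitrary multiplier `c` makes the claim stable under span induction; homogeneity of `G`
    -- can be dropped because the `d`-th derivatives of `F` vanish outright.
    suffices hG' : ∀ c, apolar (c * G) F = 0 by simpa using hG' 1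
    clear * - hA hF h hG
    induction hG using Submodule.span_induction with
    | zero => simp
    | add p q _ _ hp hq => simp [mul_add, hp, hq]
    | smul a p _ hp =>
      intro c
      rw [smul_eq_mul, ← mul_assoc]
      exact hp _
    | mem p hp =>
      obtain ⟨v, hv, rfl⟩ := hp
      intro c
      rw [mul_comm, apolar_linForm_pow_mul,
        (iterate_dirDeriv_eq_zero_iff (hA v hv) hF).2 (h v hv), map_zero]

/-- Macaulay duality for ideals generated by powers of linear forms: the degree `d + t` part of
the quotient has the dimension of the space of forms that vanish to order `t + 1` along the
corresponding lines. -/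
theorem finrank_quotient_powers {A : Set (Fin n → k)} (hA : ∀ v ∈ A, v ≠ 0) {d t : ℕ}
    {K : Ideal (MvPolynomial (Fin n) k)}
    (hK : ∀ F : MvPolynomial (Fin n) k, F.IsHomogeneous (d + t) →
      (F ∈ K ↔ ∀ v ∈ A, F ∈ lineIdeal v ^ (t + 1))) :
    Module.finrank k (homogeneousSubmodule (Fin n) k (d + t) ⧸
      ((Ideal.span ((fun v => linForm v ^ d) '' A)).restrictScalars k).comap
        (homogeneousSubmodule (Fin n) k (d + t)).subtype) =
    Module.finrank k (idealPiece K (d + t)) := by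
  rw [Submodule.finrank_quotient, ← LinearMap.BilinForm.finrank_orthogonal
    (apolarForm_nondegenerate (d + t))]
  rw [← Submodule.finrank_map_subtype_eq]
  suffices h : ((apolarForm k n (d + t)).orthogonal
      (((Ideal.span ((fun v => linForm v ^ d) '' A)).restrictScalars k).comap
        (homogeneousSubmodule (Fin n) k (d + t)).subtype)).map
      (homogeneousSubmodule (Fin n) k (d + t)).subtype = idealPiece K (d + t) by rw [h]
  ext F
  rw [idealPiece, Submodule.mem_inf, Submodule.mem_map]
  constructor
  · rintro ⟨F, h, rfl⟩
    refine ⟨(hK F F.2).2 ((apolar_powers_iff hA F.2).1 fun G hG hG' => ?_), F.2⟩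
    exact h ⟨G, hG'⟩ hG
  · rintro ⟨h, hF⟩
    refine ⟨⟨F, hF⟩, fun G hG => ?_, rfl⟩
    exact (apolar_powers_iff hA hF).2 ((hK F hF).1 h) G hG G.2

end Apolarity

end

end Geproci

namespace Geproci

noncomputable section

/-! ### Dimensions of the graded pieces of powers of a complete intersection. -/

section Dimension

variable {k : Type*} [Field k]

theorem finrank_homogeneousSubmodule (m : ℕ) :
    Module.finrank k (homogeneousSubmodule (Fin 3) k m) = (m + 2).choose 2 := by
  classical
  rw [homogeneousSubmodule_eq_finsupp_supported]
  rw [(AddMonoidAlgebra.supportedEquivFinsupp (R := k) (S := k)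
    {d : Fin 3 →₀ ℕ | d.degree = m}).finrank_eq]
  have hs : {d : Fin 3 →₀ ℕ | d.degree = m} =
      ((Finset.univ : Finset (Fin 3)).finsuppAntidiag m : Set (Fin 3 →₀ ℕ)) := by
    ext d
    simp [Finset.mem_finsuppAntidiag, Finsupp.degree_eq_sum]
  rw [hs, Module.finrank_finsupp_self, ← Nat.card_eq_fintype_card,
    Nat.card_coe_set_eq, Set.ncard_coe_finset,
    Finset.card_finsuppAntidiag_nat_eq_choose, Finset.card_univ, Fintype.card_fin,
    show 3 + m - 1 = m + 2 by omega, Nat.choose_symm_add]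

variable {N : ℕ}

/-- Forms of degree `m - e`, understood to be zero if `m < e`. -/
def shiftedForms (k : Type*) [Field k] (N m e : ℕ) : Submodule k (MvPolynomial (Fin N) k) :=
  if e ≤ m then homogeneousSubmodule (Fin N) k (m - e) else ⊥

theorem mem_shiftedForms {m e : ℕ} {c : MvPolynomial (Fin N) k} :
    c ∈ shiftedForms k N m e ↔ c = 0 ∨ e ≤ m ∧ c.IsHomogeneous (m - e) := by
  rw [shiftedForms]
  split_ifs with h
  · simp only [mem_homogeneousSubmodule, h, true_and]
    exact ⟨Or.inr, fun h => h.elim (fun h => h ▸ isHomogeneous_zero _ _ _) id⟩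
  · simp [h]

instance finite_shiftedForms (m e : ℕ) : Module.Finite k (shiftedForms k N m e) := by
  rw [Module.Finite.iff_fg, shiftedForms]
  split_ifs
  · exact homogeneousSubmodule_fg (Fin N) k _
  · exact Submodule.fg_bot

/-- For `e > m` the truncated difference `m + 2 - e` is at most `1`, so the binomial coefficient
vanishes as it should. -/
theorem finrank_shiftedForms (m e : ℕ) :
    Module.finrank k (shiftedForms k 3 m e) = (m + 2 - e).choose 2 := by
  by_cases h : e ≤ m
  · rw [shiftedForms, if_pos h, finrank_homogeneousSubmodule, Nat.sub_add_comm h]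
  · rw [shiftedForms, if_neg h, finrank_bot, Nat.choose_eq_zero_of_lt (by omega)]

theorem mul_isHomogeneous_of_mem_shiftedForms {m e : ℕ} {c h : MvPolynomial (Fin N) k}
    (hc : c ∈ shiftedForms k N m e) (hh : h.IsHomogeneous e) : (c * h).IsHomogeneous m := by
  rcases mem_shiftedForms.1 hc with rfl | ⟨he, hc⟩
  · simpa using isHomogeneous_zero _ _ _
  · simpa [he] using hc.mul hh

theorem exists_homogeneousComponent_mul (m : ℕ) {e : ℕ} {h : MvPolynomial (Fin N) k}
    (hh : h.IsHomogeneous e) (c : MvPolynomial (Fin N) k) :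
    ∃ c' ∈ shiftedForms k N m e, homogeneousComponent m (c * h) = c' * h := by
  induction c using MvPolynomial.induction_on' with
  | add p q hp hq =>
    obtain ⟨p', hp', hp⟩ := hp
    obtain ⟨q', hq', hq⟩ := hq
    exact ⟨p' + q', Submodule.add_mem _ hp' hq', by rw [add_mul, map_add, hp, hq, add_mul]⟩
  | monomial α a =>
    have hα : (monomial α a * h).IsHomogeneous (α.degree + e) :=
      (isHomogeneous_monomial a rfl).mul hh
    by_cases hm : α.degree + e = m
    · refine ⟨monomial α a, mem_shiftedForms.2 (Or.inr ⟨by omega, ?_⟩), ?_⟩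
      · exact isHomogeneous_monomial a (by omega)
      · exact homogeneousComponent_eq_self (hm ▸ hα)
    · refine ⟨0, Submodule.zero_mem _, ?_⟩
      rw [homogeneousComponent_of_mem hα, if_neg (Ne.symm hm), zero_mul]

variable {f g : MvPolynomial (Fin N) k} {a b : ℕ}

theorem monomial_isHomogeneous (hfa : f.IsHomogeneous a) (hgb : g.IsHomogeneous b) (i j : ℕ) :
    (f ^ i * g ^ j).IsHomogeneous (a * i + b * j) :=
  (hfa.pow i).mul (hgb.pow j)

/-- In degrees below that of the first syzygies there is no relation between the monomials of
degree `n` in a regular sequence. -/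
theorem coeff_eq_zero_of_relation (hfa : f.IsHomogeneous a)
    (hf : ∀ c, f * c = 0 → c = 0) (hg : ∀ c, f ∣ g * c → f ∣ c) (hab : a ≤ b) {n m : ℕ}
    (hm : m < a * n + b) {c : ℕ → MvPolynomial (Fin N) k}
    (hc : ∀ i ≤ n, c i ∈ shiftedForms k N m (a * (n - i) + b * i))
    (h : ∑ i ∈ Finset.range (n + 1), c i * (f ^ (n - i) * g ^ i) = 0) : ∀ i ≤ n, c i = 0 := by
  induction n generalizing m c with
  | zero =>
    intro i hi
    obtain rfl := Nat.le_zero.1 hi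
    simpa using h
  | succ n ih =>
    obtain ⟨q, hq, hr⟩ := relation_step hf hg h
    have hf0 : f ≠ 0 := fun h0 => one_ne_zero (hf 1 (by rw [h0, zero_mul]))
    -- A nonzero multiple of `f` has degree at least `a`, whereas this coefficient has degree `m - b
    -- * (n + 1)`, which is less than `a` by `hm` and `a ≤ b`.
    have hlast : c (n + 1) = 0 := by
      by_contra h0
      rcases mem_shiftedForms.1 (hc (n + 1) le_rfl) with h1 | ⟨h1, h2⟩
      · exact h0 h1
      have h3 := h2.totalDegree h0
      have hq0 : q ≠ 0 := fun h => h0 (by rw [hq, h, mul_zero])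
      rw [hq, totalDegree_mul_of_isDomain hf0 hq0, hfa.totalDegree hf0] at h3
      have h4 : a * n ≤ b * n := Nat.mul_le_mul_right n hab
      rw [Nat.sub_self] at h1 h3
      rw [mul_add, mul_one] at hm
      rw [mul_add, mul_one] at h1 h3
      omega
    have hq0 : q = 0 := hf q (by rw [← hq, hlast])
    simp only [hq0, zero_mul, ite_self, add_zero] at hr
    intro i hi
    rcases hi.eq_or_lt with rfl | hi
    · exact hlast
    -- Cancelling `f` lowers both the degree of the relation and the bound by `a`.
    refine ih (m := m - a) ?_ ?_ hr i (by omega)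
    · rw [mul_add, mul_one] at hm
      omega
    · intro j hj
      have h1 := hc j (by omega)
      rw [Nat.sub_add_comm hj, mul_add, mul_one] at h1
      rw [mem_shiftedForms] at h1 ⊢
      refine h1.imp_right fun ⟨h2, h3⟩ => ⟨by omega, ?_⟩
      rwa [show m - a - (a * (n - j) + b * j) = m - (a * (n - j) + a + b * j) by omega]

/-- The linear map sending coefficients to the combination of the monomials of degree `n`. -/
def combination (f g : MvPolynomial (Fin N) k) (a b n m : ℕ) :
    (∀ i : Fin (n + 1), shiftedForms k N m (a * (n - i) + b * i)) →ₗ[k]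
      MvPolynomial (Fin N) k :=
  ∑ i : Fin (n + 1), LinearMap.mulRight k (f ^ (n - i : ℕ) * g ^ (i : ℕ)) ∘ₗ
    (shiftedForms k N m _).subtype ∘ₗ LinearMap.proj i

theorem combination_apply (n m : ℕ)
    (c : ∀ i : Fin (n + 1), shiftedForms k N m (a * (n - i) + b * i)) :
    combination f g a b n m c = ∑ i : Fin (n + 1), (c i : MvPolynomial (Fin N) k) *
      (f ^ (n - i : ℕ) * g ^ (i : ℕ)) := by
  simp only [combination, LinearMap.sum_apply, LinearMap.comp_apply, LinearMap.proj_apply,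
    Submodule.subtype_apply, LinearMap.mulRight_apply]

theorem combination_injective (hfa : f.IsHomogeneous a)
    (hf : ∀ c, f * c = 0 → c = 0) (hg : ∀ c, f ∣ g * c → f ∣ c) (hab : a ≤ b) {n m : ℕ}
    (hm : m < a * n + b) : Function.Injective (combination f g a b n m) := by
  rw [← LinearMap.ker_eq_bot, LinearMap.ker_eq_bot']
  intro c hc
  have h := coeff_eq_zero_of_relation hfa hf hg hab hm
    (c := fun i => if h : i < n + 1 then c ⟨i, h⟩ else 0) (fun i hi => ?_) ?_
  · funext i
    have hi := h i (Nat.lt_succ_iff.1 i.2)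
    rw [dif_pos i.2] at hi
    exact Subtype.ext hi
  · rw [dif_pos (Nat.lt_succ_of_le hi)]
    exact (c ⟨i, _⟩).2
  · rw [← hc, combination_apply, Finset.sum_range]
    exact Finset.sum_congr rfl fun i _ => by rw [dif_pos i.2]

/-- A form of degree `m` in the power may have coefficients of mixed degrees; taking the degree `m`
component of each term makes them homogeneous. -/
theorem range_combination (hfa : f.IsHomogeneous a) (hgb : g.IsHomogeneous b) (n m : ℕ) :
    LinearMap.range (combination f g a b n m) = idealPiece (Ideal.span {f, g} ^ n) m := by
  ext F
  rw [idealPiece, Submodule.mem_inf, Submodule.restrictScalars_mem, mem_homogeneousSubmodule]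
  constructor
  · rintro ⟨c, rfl⟩
    rw [combination_apply]
    constructor
    · have h := sum_mem_span_pair_pow (f := f) (g := g) n
        fun i => if h : i < n + 1 then (c ⟨i, h⟩ : MvPolynomial (Fin N) k) else 0
      rw [Finset.sum_range] at h
      simpa only [dif_pos (Fin.is_lt _)] using h
    · exact IsHomogeneous.sum _ _ _ fun i _ =>
        mul_isHomogeneous_of_mem_shiftedForms (c i).2 (monomial_isHomogeneous hfa hgb _ _)
  · rintro ⟨hF, hFm⟩
    obtain ⟨c, hc⟩ := exists_sum_of_mem_span_pair_pow hF
    choose c' hc' hcc' using fun i : Fin (n + 1) =>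
      exists_homogeneousComponent_mul m (monomial_isHomogeneous hfa hgb (n - i) i) (c i)
    refine ⟨fun i => ⟨c' i, hc' i⟩, ?_⟩
    rw [combination_apply, ← homogeneousComponent_eq_self hFm, hc, map_sum, Finset.sum_range]
    exact Finset.sum_congr rfl fun i _ => (hcc' i).symm

theorem finrank_idealPiece_span_pair_pow {f g : MvPolynomial (Fin 3) k}
    (hfa : f.IsHomogeneous a) (hgb : g.IsHomogeneous b)
    (hf : ∀ c, f * c = 0 → c = 0) (hg : ∀ c, f ∣ g * c → f ∣ c) (hab : a ≤ b) {n m : ℕ}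
    (hm : m < a * n + b) :
    Module.finrank k (idealPiece (Ideal.span {f, g} ^ n) m) =
      ∑ i ∈ Finset.range (n + 1), (m + 2 - (a * (n - i) + b * i)).choose 2 := by
  rw [← range_combination hfa hgb, LinearMap.finrank_range_of_inj
    (combination_injective hfa hf hg hab hm), Module.finrank_pi_fintype, Finset.sum_range]
  exact Finset.sum_congr rfl fun i _ => finrank_shiftedForms _ _

end Dimension

end

end Geproci

namespace Geproci

noncomputable section

/-! ### The ideal of a finite set of points and its powers. -/

section VanishingIdeal

variable {k : Type*} [Field k] {n : ℕ}

theorem vanishingIdeal_eq_iInf (Z : Set (Projectivization k (Fin n → k))) :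
    vanishingIdeal Z = ⨅ z : Z, lineIdeal z.1.rep := by
  apply le_antisymm
  · refine le_iInf fun z => Ideal.span_le.2 ?_
    rintro F ⟨⟨m, hF⟩, h⟩
    refine (mem_lineIdeal_of_isHomogeneous hF).2 (h z z.2 _ ?_)
    rw [Projectivization.submodule_eq]
    exact Submodule.mem_span_singleton_self _
  · intro F hF
    rw [Ideal.mem_iInf] at hF
    rw [← sum_homogeneousComponent F]
    refine Ideal.sum_mem _ fun m _ => Ideal.subset_span
      ⟨⟨m, homogeneousComponent_isHomogeneous m F⟩, fun z hz v hv => ?_⟩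
    rw [Projectivization.submodule_eq] at hv
    obtain ⟨c, rfl⟩ := Submodule.mem_span_singleton.1 hv
    rw [eval_smul_eq, mem_lineIdeal.1 (homogeneousComponent_mem_lineIdeal (hF ⟨z, hz⟩) m),
      Polynomial.eval_zero]

/-- The forms `z_j x_i - z_i x_j` vanish on the line of `z`, and their vanishing at `w` forces
proportionality. -/
theorem eq_of_lineIdeal_le {z w : Projectivization k (Fin n → k)}
    (h : lineIdeal z.rep ≤ lineIdeal w.rep) : z = w := by
  obtain ⟨j, hj⟩ := Function.ne_iff.1 z.rep_nonzero
  rw [Pi.zero_apply] at hj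
  have h1 : ∀ i, w.rep i = w.rep j * (z.rep j)⁻¹ * z.rep i := by
    intro i
    have hm : ∀ v : Fin n → k, C (z.rep j) * X i - C (z.rep i) * X j ∈ lineIdeal v ↔
        z.rep j * v i - z.rep i * v j = 0 := fun v => by
      rw [mem_lineIdeal_of_isHomogeneous
        ((isHomogeneous_C_mul_X _ i).sub (isHomogeneous_C_mul_X _ j))]
      simp
    have h2 := (hm _).1 (h ((hm _).2 (by ring)))
    field_simp
    linear_combination h2
  rw [← z.mk_rep, ← w.mk_rep, eq_comm, Projectivization.mk_eq_mk_iff']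
  exact ⟨w.rep j * (z.rep j)⁻¹, funext fun i => (h1 i).symm⟩

/-- For a complete intersection of reduced points, a form lies in a power of the ideal if and
only if it vanishes to the corresponding order at each of the points. -/
theorem mem_vanishingIdeal_pow_iff {Z : Set (Projectivization k (Fin n → k))} (hZ : Z.Finite)
    {f g : MvPolynomial (Fin n) k} (hf : ∀ c, f * c = 0 → c = 0)
    (hg : ∀ c, f ∣ g * c → f ∣ c) (hI : vanishingIdeal Z = Ideal.span {f, g}) (m : ℕ)
    (F : MvPolynomial (Fin n) k) :
    F ∈ vanishingIdeal Z ^ m ↔ ∀ z ∈ Z, F ∈ lineIdeal z.rep ^ m := by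
  constructor
  · intro h z hz
    refine Ideal.pow_right_mono ?_ m h
    rw [vanishingIdeal_eq_iInf]
    exact iInf_le (fun z : Z => lineIdeal z.1.rep) ⟨z, hz⟩
  · intro h
    have := hZ.to_subtype
    rw [hI]
    exact mem_span_pair_pow_of_forall hf hg (J := fun z : Z => lineIdeal z.1.rep)
      (fun z => lineIdeal_isPrime _) (fun z w hzw => Subtype.ext (eq_of_lineIdeal_le hzw))
      (hI.symm.trans (vanishingIdeal_eq_iInf Z)) m fun z => h z z.2

end VanishingIdeal

/-! ### Linear substitutions between polynomial rings. -/

section Substitution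

variable {k : Type*} [Field k] {p q : ℕ}

/-- `linForm` as a linear map. -/
def linFormHom (k : Type*) [Field k] (p : ℕ) : (Fin p → k) →ₗ[k] MvPolynomial (Fin p) k where
  toFun := linForm
  map_add' v w := by simp [linForm, add_mul, Finset.sum_add_distrib]
  map_smul' c v := by simp [linForm, Finset.smul_sum, smul_eq_C_mul, mul_assoc]

theorem linForm_smul (c : k) (v : Fin p → k) : linForm (c • v) = C c * linForm v := by
  rw [C_mul']
  exact (linFormHom k p).map_smul c v

theorem linForm_single (i : Fin p) : linForm (Pi.single i (1 : k)) = X i := by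
  simp [linForm, Pi.single_apply]

/-- The linear substitution that induces the linear map `T` on linear forms. -/
def substitution (T : (Fin p → k) →ₗ[k] (Fin q → k)) :
    MvPolynomial (Fin p) k →ₐ[k] MvPolynomial (Fin q) k :=
  aeval fun i => linForm (T (Pi.single i 1))

theorem substitution_linForm (T : (Fin p → k) →ₗ[k] (Fin q → k)) (v : Fin p → k) :
    substitution T (linForm v) = linForm (T v) := by
  have h : (substitution T).toLinearMap ∘ₗ linFormHom k p = linFormHom k q ∘ₗ T := by
    refine LinearMap.pi_ext' fun i => LinearMap.ext_ring ?_
    change substitution T (linForm (Pi.single i 1)) = linForm (T (Pi.single i 1))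
    rw [linForm_single, substitution, aeval_X]
  exact LinearMap.congr_fun h v

theorem substitution_isHomogeneous (T : (Fin p → k) →ₗ[k] (Fin q → k))
    {F : MvPolynomial (Fin p) k} {m : ℕ} (hF : F.IsHomogeneous m) :
    (substitution T F).IsHomogeneous m := by
  have h := hF.aeval (n := 1) _ fun i => linForm_isHomogeneous (T (Pi.single i 1))
  rwa [one_mul] at h

theorem substitution_substitution {T : (Fin p → k) →ₗ[k] (Fin q → k)}
    {T' : (Fin q → k) →ₗ[k] (Fin p → k)} (h : ∀ v, T (T' v) = v)
    (F : MvPolynomial (Fin q) k) : substitution T (substitution T' F) = F := by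
  have hh : (substitution T).comp (substitution T') = AlgHom.id k _ := by
    refine algHom_ext fun i => ?_
    rw [AlgHom.comp_apply, ← linForm_single, substitution_linForm, substitution_linForm, h,
      AlgHom.id_apply]
  exact DFunLike.congr_fun hh F

/-- Modulo `linForm u` the composite fixes every variable, hence everything. This identifies the
kernel of the substitution attached to a projection from `u`. -/
theorem sub_substitution_mem {T : (Fin p → k) →ₗ[k] (Fin q → k)}
    {T' : (Fin q → k) →ₗ[k] (Fin p → k)} {u : Fin p → k}
    (hu : ∀ v, ∃ c : k, v - T' (T v) = c • u) (F : MvPolynomial (Fin p) k) :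
    F - substitution T' (substitution T F) ∈ Ideal.span {linForm u} := by
  rw [← Ideal.Quotient.eq]
  have hh : (Ideal.Quotient.mkₐ k (Ideal.span {linForm u})) =
      (Ideal.Quotient.mkₐ k (Ideal.span {linForm u})).comp
        ((substitution T').comp (substitution T)) := by
    refine algHom_ext fun i => ?_
    rw [AlgHom.comp_apply, AlgHom.comp_apply, ← linForm_single, substitution_linForm,
      substitution_linForm, Ideal.Quotient.mkₐ_eq_mk, Ideal.Quotient.eq]
    obtain ⟨c, hc⟩ := hu (Pi.single i 1)
    have h1 : linForm (Pi.single i 1) - linForm (T' (T (Pi.single i 1))) = C c * linForm u := by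
      rw [← linForm_smul, ← hc]
      exact ((linFormHom k p).map_sub _ _).symm
    rw [h1]
    exact Ideal.mul_mem_left _ _ (Ideal.mem_span_singleton_self _)
  exact DFunLike.congr_fun hh F

end Substitution

/-! ### The cokernel as a graded piece in fewer variables. -/

section Cokernel

variable {k : Type*} [Field k] {p q : ℕ}

attribute [local instance] MvPolynomial.gradedAlgebra in
theorem homogeneousComponent_mem_powerIdeal (X : Set (Projectivization k (Fin p → k))) (d : ℕ)
    {F : MvPolynomial (Fin p) k} (hF : F ∈ powerIdeal X d) (m : ℕ) :
    homogeneousComponent m F ∈ powerIdeal X d := by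
  refine homogeneousComponent_mem_of_mem (Ideal.homogeneous_span _ _ ?_) hF m
  rintro _ ⟨x, _, rfl⟩
  exact ⟨1 * d, (linForm_isHomogeneous x.rep).pow d⟩

/-- The cokernel of multiplication by the linear form dual to `P` is a graded piece of a quotient
of a polynomial ring in fewer variables. -/
theorem finrank_coker_mulDual {I : Ideal (MvPolynomial (Fin p) k)}
    (hI : ∀ F ∈ I, ∀ m, homogeneousComponent m F ∈ I)
    {P : Projectivization k (Fin p → k)} {T : (Fin p → k) →ₗ[k] (Fin q → k)}
    {T' : (Fin q → k) →ₗ[k] (Fin p → k)} (hTT' : ∀ v, T (T' v) = v) (hTP : T P.rep = 0)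
    (hu : ∀ v, ∃ c : k, v - T' (T v) = c • P.rep) {m : ℕ} (hm : 0 < m) :
    Module.finrank k (quotPiece I m ⧸ LinearMap.range (mulDual I P hm)) =
      Module.finrank k (homogeneousSubmodule (Fin q) k m ⧸
        ((I.map (substitution T)).restrictScalars k).comap
          (homogeneousSubmodule (Fin q) k m).subtype) := by
  -- Both quotients are images of the same space of forms of degree `m`, so it suffices that the
  -- surjections `A` and `B` have the same kernel.
  let A : homogeneousSubmodule (Fin p) k m →ₗ[k] quotPiece I m ⧸ LinearMap.range (mulDual I P hm) :=
    (Submodule.mkQ _) ∘ₗ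
      (Ideal.Quotient.mkₐ k I).toLinearMap.restrict (q := quotPiece I m) fun F hF => ⟨F, hF, rfl⟩
  let B : homogeneousSubmodule (Fin p) k m →ₗ[k] (homogeneousSubmodule (Fin q) k m ⧸
        ((I.map (substitution T)).restrictScalars k).comap
          (homogeneousSubmodule (Fin q) k m).subtype) :=
    (Submodule.mkQ _) ∘ₗ (substitution T).toLinearMap.restrict
      (q := homogeneousSubmodule (Fin q) k m) fun F hF => substitution_isHomogeneous T hF
  have hA : Function.Surjective A := by
    refine (Submodule.mkQ_surjective _).comp ?_
    rintro ⟨_, F, hF, rfl⟩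
    exact ⟨⟨F, hF⟩, rfl⟩
  have hB : Function.Surjective B := by
    refine (Submodule.mkQ_surjective _).comp ?_
    rintro ⟨F, hF⟩
    exact ⟨⟨substitution T' F, substitution_isHomogeneous T' hF⟩,
      Subtype.ext (substitution_substitution hTT' F)⟩
  have hsurj : Function.Surjective (substitution T) :=
    fun F => ⟨_, substitution_substitution hTT' F⟩
  have hker : LinearMap.ker A = LinearMap.ker B := by
    ext F
    have hFA : F ∈ LinearMap.ker A ↔ ∃ G : MvPolynomial (Fin p) k, G.IsHomogeneous (m - 1) ∧
        dualForm P * G - F ∈ I := by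
      rw [LinearMap.mem_ker, LinearMap.comp_apply, Submodule.mkQ_apply,
        Submodule.Quotient.mk_eq_zero]
      constructor
      · rintro ⟨⟨_, G, hG, rfl⟩, h⟩
        refine ⟨G, hG, Ideal.Quotient.eq.1 ?_⟩
        rw [map_mul]
        exact congrArg Subtype.val h
      · rintro ⟨G, hG, h⟩
        refine ⟨⟨_, G, hG, rfl⟩, Subtype.ext ?_⟩
        have h1 := Ideal.Quotient.eq.2 h
        rw [map_mul] at h1
        exact h1
    have hFB : F ∈ LinearMap.ker B ↔ substitution T F ∈ I.map (substitution T) := by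
      rw [LinearMap.mem_ker, LinearMap.comp_apply, Submodule.mkQ_apply,
        Submodule.Quotient.mk_eq_zero]
      rfl
    rw [hFA, hFB]
    have hP : substitution T (dualForm P) = 0 := by
      rw [dualForm, substitution_linForm, hTP]
      exact (linFormHom k q).map_zero
    constructor
    · rintro ⟨G, -, h⟩
      have h1 := Ideal.mem_map_of_mem (substitution T) h
      rw [map_sub, map_mul, hP, zero_mul, zero_sub] at h1
      exact (Ideal.neg_mem_iff _).1 h1
    · intro h
      -- Lift the image of `F` to `E` in `I`. Then `F - E` is a multiple of the dual form, and its
      -- degree `m` component gives the required cofactor of degree `m - 1`.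
      obtain ⟨E, hE, hEF⟩ := (Ideal.mem_map_iff_of_surjective _ hsurj).1 h
      have h1 := sub_substitution_mem hu (F - E)
      rw [map_sub, hEF, sub_self, map_zero, sub_zero] at h1
      obtain ⟨G, hG⟩ := Ideal.mem_span_singleton.1 h1
      obtain ⟨G', hG', hGG'⟩ := exists_homogeneousComponent_mul m (linForm_isHomogeneous P.rep) G
      refine ⟨G', ?_, ?_⟩
      · rcases mem_shiftedForms.1 hG' with rfl | h2
        · exact isHomogeneous_zero _ _ _
        · exact h2.2
      · have h3 : F - homogeneousComponent m E = G' * linForm P.rep := by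
          rw [← hGG', mul_comm, ← hG, map_sub, homogeneousComponent_eq_self F.2]
        rw [dualForm, mul_comm, ← h3, sub_sub_cancel_left]
        exact Ideal.neg_mem_iff _ |>.2 (hI E hE m)
  exact ((LinearMap.quotKerEquivOfSurjective A hA).symm ≪≫ₗ
    Submodule.quotEquivOfEq _ _ hker ≪≫ₗ LinearMap.quotKerEquivOfSurjective B hB).finrank_eq

end Cokernel

/-! ### Projection from a point, and the cokernel formula. -/

section Projection

variable {k : Type*} [Field k] (P : Projectivization k (Fin 4 → k))
  (H : Submodule k (Fin 4 → k)) (hH : IsCompl H P.submodule) (e : H ≃ₗ[k] (Fin 3 → k))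

theorem project_finite {X : Set (Projectivization k (Fin 4 → k))} (hX : X.Finite) :
    (project P H hH e X).Finite := by
  refine ((hX.image fun x => x.submodule.map
    (e.toLinearMap ∘ₗ H.projectionOnto P.submodule hH)).preimage
      (Projectivization.submodule_injective (K := k) (V := Fin 3 → k)).injOn).subset ?_
  rintro y ⟨x, hx, hy⟩
  exact ⟨x, hx, hy.symm⟩

theorem map_powerIdeal (X : Set (Projectivization k (Fin 4 → k))) {d : ℕ} (hd : 0 < d) :
    (powerIdeal X d).map (substitution (e.toLinearMap ∘ₗ H.projectionOnto P.submodule hH)) =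
      Ideal.span ((fun v => linForm v ^ d) '' (Projectivization.rep '' project P H hH e X)) := by
  rw [powerIdeal, Ideal.map_span]
  apply le_antisymm <;> rw [Ideal.span_le]
  · rintro _ ⟨_, ⟨x, hx, rfl⟩, rfl⟩
    simp only [dualForm, map_pow, substitution_linForm]
    -- A point of `X` equal to `P` has no projection; its dual form maps to zero, and so does its
    -- `d`-th power since `d > 0`.
    by_cases h0 : (e.toLinearMap ∘ₗ H.projectionOnto P.submodule hH) x.rep = 0
    · rw [h0, show linForm (0 : Fin 3 → k) = 0 from (linFormHom k 3).map_zero,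
        zero_pow hd.ne']
      exact Ideal.zero_mem _
    · obtain ⟨c, hc⟩ := Projectivization.exists_smul_eq_mk_rep k _ h0
      have hz : Projectivization.mk k _ h0 ∈ project P H hH e X := by
        refine ⟨x, hx, ?_⟩
        rw [Projectivization.submodule_mk, Projectivization.submodule_eq x, Submodule.map_span,
          Set.image_singleton]
      have hc' := congrArg (fun v => (c⁻¹ : kˣ) • v) hc
      simp only [inv_smul_smul] at hc'
      rw [hc', Units.smul_def, linForm_smul, mul_pow]
      exact Ideal.mul_mem_left _ _ (Ideal.subset_span ⟨_, ⟨_, hz, rfl⟩, rfl⟩)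
  · rintro _ ⟨_, ⟨z, ⟨x, hx, hz⟩, rfl⟩, rfl⟩
    have h1 : z.rep ∈ z.submodule := by
      rw [Projectivization.submodule_eq]
      exact Submodule.mem_span_singleton_self _
    rw [hz, Projectivization.submodule_eq x, Submodule.map_span, Set.image_singleton] at h1
    obtain ⟨c, hc⟩ := Submodule.mem_span_singleton.1 h1
    simp only [SetLike.mem_coe]
    rw [← hc, linForm_smul, mul_pow]
    refine Ideal.mul_mem_left _ _ (Ideal.subset_span ⟨_, ⟨x, hx, rfl⟩, ?_⟩)
    simp only [dualForm, map_pow, substitution_linForm]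

theorem finrank_coker_eq [CharZero k] {X : Set (Projectivization k (Fin 4 → k))} (hX : X.Finite)
    {f g : MvPolynomial (Fin 3) k} (hf : ∀ c, f * c = 0 → c = 0)
    (hg : ∀ c, f ∣ g * c → f ∣ c)
    (hI : vanishingIdeal (project P H hH e X) = Ideal.span {f, g}) {d t : ℕ} (hd : 0 < d) :
    Module.finrank k (quotPiece (powerIdeal X d) (d + t) ⧸
        LinearMap.range (mulDual (powerIdeal X d) P (Nat.add_pos_left hd t))) =
      Module.finrank k (idealPiece (vanishingIdeal (project P H hH e X) ^ (t + 1)) (d + t)) := by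
  rw [finrank_coker_mulDual (fun F hF m => homogeneousComponent_mem_powerIdeal X d hF m)
    (T := e.toLinearMap ∘ₗ H.projectionOnto P.submodule hH)
    (T' := H.subtype ∘ₗ e.symm.toLinearMap), map_powerIdeal P H hH e X hd]
  · refine finrank_quotient_powers ?_ fun F _ => ?_
    · rintro _ ⟨z, -, rfl⟩
      exact z.rep_nonzero
    · rw [mem_vanishingIdeal_pow_iff (project_finite P H hH e hX) hf hg hI, Set.forall_mem_image]
  · intro v
    simp
  · have h : P.rep ∈ P.submodule := by
      rw [Projectivization.submodule_eq]
      exact Submodule.mem_span_singleton_self _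
    simp [h]
  · intro v
    have h : v - H.projectionOnto P.submodule hH v ∈ P.submodule := by
      rw [← Submodule.projectionOnto_apply_eq_zero_iff hH]
      rw [map_sub, Submodule.projectionOnto_apply_left, sub_self]
    obtain ⟨c, hc⟩ := Submodule.mem_span_singleton.1 (P.submodule_eq.le h)
    exact ⟨c, by simpa using hc.symm⟩

theorem exists_complement (P : Projectivization k (Fin 4 → k)) :
    ∃ H : Submodule k (Fin 4 → k), IsCompl H P.submodule ∧ Nonempty (H ≃ₗ[k] (Fin 3 → k)) := by
  obtain ⟨H, hH⟩ := Submodule.exists_isCompl P.submodule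
  refine ⟨H, hH.symm, ⟨LinearEquiv.ofFinrankEq _ _ ?_⟩⟩
  have h := Submodule.finrank_add_eq_of_isCompl hH
  rw [Projectivization.finrank_submodule, Module.finrank_fin_fun] at h
  rw [Module.finrank_fin_fun]
  omega

end Projection

end

end Geproci

theorem mainTheorem4 {k : Type*} [Field k] [CharZero k] (a b : ℕ)
    (X : Set (Projectivization k (Fin 4 → k))) (hX : Geproci.IsGeproci a b X) :
    Geproci.ForGeneralPoint fun P : Projectivization k (Fin 4 → k) =>
      ∀ (d t : ℕ) (hd : 0 < d),
        (∀ (H : Submodule k (Fin 4 → k)) (hH : IsCompl H P.submodule)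
            (e : H ≃ₗ[k] (Fin 3 → k)),
          Module.finrank k (Geproci.quotPiece (Geproci.powerIdeal X d) (d + t) ⧸
              LinearMap.range (Geproci.mulDual (Geproci.powerIdeal X d) P
                (Nat.add_pos_left hd t))) =
            Module.finrank k (Geproci.idealPiece
              (Geproci.vanishingIdeal (Geproci.project P H hH e X) ^ (t + 1)) (d + t))) ∧
        (a ≤ b → d + t < a * (t + 1) + b →
          Module.finrank k (Geproci.quotPiece (Geproci.powerIdeal X d) (d + t) ⧸
              LinearMap.range (Geproci.mulDual (Geproci.powerIdeal X d) P
                (Nat.add_pos_left hd t))) =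
            ∑ i ∈ Finset.range (t + 2),
              Nat.choose ((d : ℤ) + t + 2 - a * (t + 1) - (b - a) * i).toNat 2) := by
  obtain ⟨hfin, Φ, hΦ, hΦ0, hgen⟩ := hX
  -- The open set of the geproci condition serves for all `d` and `t` at once.
  refine ⟨Φ, hΦ, hΦ0, fun P hP d t hd => ⟨fun H hH e => ?_, fun hab hdt => ?_⟩⟩
  · obtain ⟨f, g, -, -, hreg, hI⟩ := hgen P hP H hH e
    obtain ⟨hf, hg⟩ := Geproci.dvd_of_isRegular hreg
    exact Geproci.finrank_coker_eq P H hH e hfin hf hg hI hd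
  · obtain ⟨H, hH, ⟨e⟩⟩ := Geproci.exists_complement P
    obtain ⟨f, g, hfa, hgb, hreg, hI⟩ := hgen P hP H hH e
    obtain ⟨hf, hg⟩ := Geproci.dvd_of_isRegular hreg
    rw [Geproci.finrank_coker_eq P H hH e hfin hf hg hI hd, hI,
      Geproci.finrank_idealPiece_span_pair_pow hfa hgb hf hg hab hdt]
    refine Finset.sum_congr rfl fun i hi => congrArg (Nat.choose · 2) ?_
    have hi' : i ≤ t + 1 := Nat.lt_succ_iff.1 (Finset.mem_range.1 hi)
    -- The exponent `a * (t + 1 - i) + b * i` equals `a * (t + 1) + (b - a) * i`; truncated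
    -- subtraction of naturals then agrees with `toNat`.
    have h : (d : ℤ) + t + 2 - a * (t + 1) - (b - a) * i =
        ((d + t + 2 : ℕ) : ℤ) - (a * (t + 1 - i) + b * i : ℕ) := by
      push_cast [Nat.cast_sub hi']
      ring
    rw [h]
    omega
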